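/- **Setting.** Let $(\Gamma,+,0,\le)$ be a totally ordered abelian group. The tropical semifield $\mathbb{T}_{\max}(\Gamma)$ is $\Gamma\cup\{\bot\}$ with addition $\oplus=\max$ and multiplication $\odot=+$, where $\bot$ is the bottom element, is absorbing for $\odot$ and is the zero element. Equip $\mathbb{T}_{\max}(\Gamma)^2$ with the componentwise addition, the multiplication $$(a_1,a_2)\odot(b_1,b_2)=(a_1\odot b_1\oplus a_2\odot b_2,\;a_1\odot b_2\oplus a_2\odot b_1)$$ and the negation $\ominus(a_1,a_2)=(a_2,a_1)$. The symmetrized tropical semiring $\mathbb{S}_{\max}=\mathbb{S}_{\max}(\Gamma)$ is the quotient of $\mathbb{T}_{\max}(\Gamma)^2$ by the congruence $\mathcal R$ for which $(a_1,a_2)\,\mathcal R\,(b_1,b_2)$ means $a_1\oplus b_2=a_2\oplus b_1$ if $a_1\ne a_2$ and $b_1\ne b_2$, and $(a_1,a_2)=(b_1,b_2)$ otherwise. Write $\mathbb{0}$ for its zero element, $\mathbb{S}_{\max}^\vee$ for the set of signed elements, i.e. the classes of $(c,\bot)$ and $(\bot,c)$ with $c\in\Gamma\cup\{\bot\}$,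 and $a\preceq^\circ b$ if $b=a\oplus e$ with $e$ the class of some $(c,c)$, $c\in\Gamma\cup\{\bot\}$. A map $\mathrm{sv}$ from a field $R$ to $\mathbb{S}_{\max}$ is a morphism of semiring systems (from $R$, with tangible elements $R\setminus\{0\}$, the usual negation and equality as surpassing relation, to $\mathbb{S}_{\max}$, with tangible elements $\mathbb{S}_{\max}^\vee\setminus\{\mathbb{0}\}$, negation $\ominus$ and surpassing relation $\preceq^\circ$) if, for all $a,a'\in R$ and $b\in R\setminus\{0\}$, $$\mathrm{sv}(0)=\mathbb{0},\quad \mathrm{sv}(b)\in\mathbb{S}_{\max}^\vee\setminus\{\mathbb{0}\},\quad \mathrm{sv}(-a)=\ominus\,\mathrm{sv}(a),\quad \mathrm{sv}(a+a')\preceq^\circ\mathrm{sv}(a)\oplus\mathrm{sv}(a'),\quad \mathrm{sv}(ba)=\mathrm{sv}(b)\odot\mathrm{sv}(a).$$ Such a map takes its values in $\mathbb{S}_{\max}^\vee$. **Statement.** Assume that $\Gamma$ is divisible, let $R$ be an ordered field and let $\mathrm{sv}:R\to\mathbb{S}_{\max}^\vee(\Gamma)$ be a morphism of semiring systems. Let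 $x_1,\dots,x_n\in R$ and let $$\mathbf{P}=\sum_{k=0}^n\mathbf{P}_k\mathsf{Y}^k=(\mathsf{Y}-x_1)\cdots(\mathsf{Y}-x_n)\in R[\mathsf{Y}].$$ Let $P=\mathrm{sv}(\mathbf{P}):=\bigoplus_{k=0}^n\mathrm{sv}(\mathbf{P}_k)\,\mathsf{Y}^k$ and let $\widehat P:\mathbb{S}_{\max}\to\mathbb{S}_{\max}$, $y\mapsto\bigoplus_{k=0}^n\mathrm{sv}(\mathbf{P}_k)\odot y^{\odot k}$, be the associated polynomial function. Then $$\widehat P(y)=(y\ominus\mathrm{sv}(x_1))\odot\cdots\odot(y\ominus\mathrm{sv}(x_n))\qquad\text{for all }y\in\mathbb{S}_{\max}(\Gamma).$$ -/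

import Mathlib

set_option linter.unusedSectionVars false

open Polynomial

/-- The tropical semifield `T_max(Γ) = (Γ ∪ {⊥}, max, +)` over an ordered abelian group `Γ`. -/
def TMax (Γ : Type*) : Type _ := WithBot Γ

namespace TMax

variable {Γ : Type*} [AddCommGroup Γ] [LinearOrder Γ]

instance : LinearOrder (TMax Γ) := inferInstanceAs (LinearOrder (WithBot Γ))

/-- The zero element is the bottom element `⊥`. -/
instance : Zero (TMax Γ) := ⟨(⊥ : WithBot Γ)⟩

/-- The unit element is the neutral element of `Γ`. -/
instance : One (TMax Γ) := ⟨((0 : Γ) : WithBot Γ)⟩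

/-- Tropical addition is the maximum. -/
instance : Add (TMax Γ) := ⟨fun a b => max a b⟩

/-- Tropical multiplication is the addition of `Γ`, with `⊥` absorbing. -/
instance : Mul (TMax Γ) :=
  ⟨fun a b => (show WithBot Γ from ((show WithBot Γ from a) + (show WithBot Γ from b)))⟩

theorem add_eq_max (a b : TMax Γ) : a + b = max a b := rfl

theorem zero_le' (a : TMax Γ) : 0 ≤ a := (bot_le : (⊥ : WithBot Γ) ≤ a)

variable [IsOrderedAddMonoid Γ]

theorem mul_mono {a b : TMax Γ} (c : TMax Γ) (h : a ≤ b) : c * a ≤ c * b :=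
  add_le_add (α := WithBot Γ) le_rfl h

instance : CommSemiring (TMax Γ) where
  add_assoc a b c := max_assoc a b c
  zero_add a := max_eq_right (zero_le' a)
  add_zero a := max_eq_left (zero_le' a)
  add_comm a b := max_comm a b
  nsmul := nsmulRec
  mul_assoc a b c := add_assoc (G := WithBot Γ) a b c
  one_mul a := zero_add (M := WithBot Γ) a
  mul_one a := add_zero (M := WithBot Γ) a
  mul_comm a b := add_comm (G := WithBot Γ) a b
  zero_mul a := WithBot.bot_add (a : WithBot Γ)
  mul_zero a := WithBot.add_bot (a : WithBot Γ)
  left_distrib a b c := (show Monotone (fun x => a * x) from fun _ _ h => mul_mono a h).map_max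
  right_distrib a b c := (show Monotone (fun x => x * c) from fun x y h => by
    have := mul_mono c h
    rwa [show c * x = x * c from add_comm (G := WithBot Γ) c x,
      show c * y = y * c from add_comm (G := WithBot Γ) c y] at this).map_max

theorem mul_strictMono {a b c : TMax Γ} (hc : c ≠ 0) (h : a < b) : c * a < c * b :=
  WithBot.add_lt_add_left (α := Γ) hc h

theorem exists_inv {c : TMax Γ} (hc : c ≠ 0) : ∃ d : TMax Γ, d * c = 1 := by
  obtain ⟨g, rfl⟩ := WithBot.ne_bot_iff_exists.1 hc
  refine ⟨((-g : Γ) : WithBot Γ), ?_⟩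
  change ((-g : Γ) : WithBot Γ) + ((g : Γ) : WithBot Γ) = ((0 : Γ) : WithBot Γ)
  rw [← WithBot.coe_add, neg_add_cancel]

theorem zero_ne_one' : (0 : TMax Γ) ≠ 1 := WithBot.bot_ne_coe

end TMax

/-- Pairs `(a₁, a₂)` of elements of `T_max(Γ)`. -/
@[ext] structure TPair (Γ : Type*) where
  fst : TMax Γ
  snd : TMax Γ

namespace TPair

variable {Γ : Type*} [AddCommGroup Γ] [LinearOrder Γ] [IsOrderedAddMonoid Γ]

instance : Zero (TPair Γ) := ⟨⟨0, 0⟩⟩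
instance : One (TPair Γ) := ⟨⟨1, 0⟩⟩
instance : Add (TPair Γ) := ⟨fun a b => ⟨a.fst + b.fst, a.snd + b.snd⟩⟩
instance : Mul (TPair Γ) :=
  ⟨fun a b => ⟨a.fst * b.fst + a.snd * b.snd, a.fst * b.snd + a.snd * b.fst⟩⟩
instance : Neg (TPair Γ) := ⟨fun a => ⟨a.snd, a.fst⟩⟩

theorem add_def (a b : TPair Γ) : a + b = ⟨a.fst + b.fst, a.snd + b.snd⟩ := rfl
theorem mul_def (a b : TPair Γ) :
    a * b = ⟨a.fst * b.fst + a.snd * b.snd, a.fst * b.snd + a.snd * b.fst⟩ := rfl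
theorem zero_def : (0 : TPair Γ) = ⟨0, 0⟩ := rfl
theorem one_def : (1 : TPair Γ) = ⟨1, 0⟩ := rfl
theorem neg_def (a : TPair Γ) : -a = ⟨a.snd, a.fst⟩ := rfl

instance : CommSemiring (TPair Γ) where
  add_assoc a b c := by simp only [add_def, add_assoc]
  zero_add a := by simp only [add_def, zero_def, zero_add]
  add_zero a := by simp only [add_def, zero_def, add_zero]
  add_comm a b := by simp only [add_def, add_comm]
  nsmul := nsmulRec
  mul_assoc a b c := by
    simp only [mul_def]
    ext <;> dsimp only <;> ring
  one_mul a := by simp [mul_def, one_def]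
  mul_one a := by simp [mul_def, one_def]
  mul_comm a b := by
    simp only [mul_def]
    ext <;> dsimp only <;> ring
  zero_mul a := by simp [mul_def, zero_def]
  mul_zero a := by simp [mul_def, zero_def]
  left_distrib a b c := by
    simp only [mul_def, add_def]
    ext <;> dsimp only <;> ring
  right_distrib a b c := by
    simp only [mul_def, add_def]
    ext <;> dsimp only <;> ring

/-- The equivalence relation on pairs refining the balance relation
`a₁ ⊕ b₂ = a₂ ⊕ b₁`. -/
def Rel (a b : TPair Γ) : Prop :=
  (a.fst ≠ a.snd ∧ b.fst ≠ b.snd ∧ a.fst + b.snd = a.snd + b.fst) ∨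
    (¬ (a.fst ≠ a.snd ∧ b.fst ≠ b.snd) ∧ a = b)

theorem rel_iff (a b : TPair Γ) : Rel a b ↔
    a = b ∨ (a.snd < a.fst ∧ b.snd < b.fst ∧ a.fst = b.fst) ∨
      (a.fst < a.snd ∧ b.fst < b.snd ∧ a.snd = b.snd) := by
  obtain ⟨a₁, a₂⟩ := a
  obtain ⟨b₁, b₂⟩ := b
  simp only [Rel, TMax.add_eq_max, TPair.mk.injEq]
  grind

theorem rel_refl (a : TPair Γ) : Rel a a := (rel_iff _ _).2 (Or.inl rfl)

theorem rel_symm {a b : TPair Γ} (h : Rel a b) : Rel b a := by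
  rw [rel_iff] at h ⊢
  grind

theorem rel_trans {a b c : TPair Γ} (h : Rel a b) (h' : Rel b c) : Rel a c := by
  rw [rel_iff] at h h' ⊢
  grind

theorem rel_add_right {a b : TPair Γ} (h : Rel a b) (c : TPair Γ) : Rel (a + c) (b + c) := by
  rw [rel_iff] at h ⊢
  obtain ⟨a₁, a₂⟩ := a
  obtain ⟨b₁, b₂⟩ := b
  obtain ⟨c₁, c₂⟩ := c
  simp only [add_def, TMax.add_eq_max, TPair.mk.injEq] at h ⊢
  grind

theorem rel_neg {a b : TPair Γ} (h : Rel a b) : Rel (-a) (-b) := by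
  rw [rel_iff] at h ⊢
  obtain ⟨a₁, a₂⟩ := a
  obtain ⟨b₁, b₂⟩ := b
  simp only [neg_def, TPair.mk.injEq] at h ⊢
  grind

theorem neg_mul' (a b : TPair Γ) : -(a * b) = -a * b := by
  simp only [neg_def, mul_def]
  ext <;> dsimp only <;> ring

theorem neg_neg' (a : TPair Γ) : - -a = a := rfl

theorem mul_of_lt {a₁ a₂ b₁ b₂ : TMax Γ} (ha : a₂ < a₁) (hb : b₂ < b₁) :
    a₁ * b₂ + a₂ * b₁ < a₁ * b₁ + a₂ * b₂ ∧ a₁ * b₁ + a₂ * b₂ = a₁ * b₁ := by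
  have ha0 : a₁ ≠ 0 := (lt_of_le_of_lt (TMax.zero_le' _) ha).ne'
  have hb0 : b₁ ≠ 0 := (lt_of_le_of_lt (TMax.zero_le' _) hb).ne'
  have h1 : a₁ * b₂ < a₁ * b₁ := TMax.mul_strictMono ha0 hb
  have h2 : b₁ * a₂ < b₁ * a₁ := TMax.mul_strictMono hb0 ha
  have h3 : a₂ * b₂ ≤ a₂ * b₁ := TMax.mul_mono _ hb.le
  rw [mul_comm b₁, mul_comm b₁] at h2
  simp only [TMax.add_eq_max]
  grind

theorem rel_mul_right {a b : TPair Γ} (h : Rel a b) (c : TPair Γ) : Rel (a * c) (b * c) := by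
  have pos : ∀ {x y z : TPair Γ}, x.snd < x.fst → y.snd < y.fst → x.fst = y.fst →
      z.snd ≤ z.fst → Rel (x * z) (y * z) := by
    rintro ⟨x₁, x₂⟩ ⟨y₁, y₂⟩ ⟨z₁, z₂⟩ hx hy hxy hz
    simp only at hx hy hxy hz
    subst hxy
    rw [rel_iff]
    simp only [mul_def, TPair.mk.injEq]
    rcases hz.lt_or_eq with hz | rfl
    · obtain ⟨h1, h2⟩ := mul_of_lt hx hz
      obtain ⟨h3, h4⟩ := mul_of_lt hy hz
      exact Or.inr (Or.inl ⟨h1, h3, h2.trans h4.symm⟩)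
    · left
      have h1 : x₁ * z₂ + x₂ * z₂ = x₁ * z₂ := by
        rw [← add_mul, TMax.add_eq_max, max_eq_left hx.le]
      have h2 : x₁ * z₂ + y₂ * z₂ = x₁ * z₂ := by
        rw [← add_mul, TMax.add_eq_max, max_eq_left hy.le]
      exact ⟨h1.trans h2.symm, h1.trans h2.symm⟩
  have pos' : ∀ {x y z : TPair Γ}, x.snd < x.fst → y.snd < y.fst → x.fst = y.fst →
      Rel (x * z) (y * z) := by
    intro x y z hx hy hxy
    rcases le_total z.snd z.fst with hz | hz
    · exact pos hx hy hxy hz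
    · have h1 := rel_neg (pos (z := -z) hx hy hxy hz)
      rwa [mul_comm x, mul_comm y, neg_mul', neg_mul', neg_neg', mul_comm z, mul_comm z] at h1
  rcases (rel_iff a b).1 h with rfl | ⟨h1, h2, h3⟩ | ⟨h1, h2, h3⟩
  · exact rel_refl _
  · exact pos' h1 h2 h3
  · have h4 := rel_neg (pos' (x := -a) (y := -b) (z := c) h1 h2 h3)
    rwa [neg_mul', neg_mul', neg_neg', neg_neg'] at h4

/-- `Rel` is a congruence for both operations. -/
def con (Γ : Type*) [AddCommGroup Γ] [LinearOrder Γ] [IsOrderedAddMonoid Γ] :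
    RingCon (TPair Γ) where
  r := Rel
  iseqv := ⟨rel_refl, rel_symm, rel_trans⟩
  add' {a b c d} h h' := by
    refine rel_trans (rel_add_right h c) ?_
    rw [add_comm b c, add_comm b d]
    exact rel_add_right h' b
  mul' {a b c d} h h' := by
    refine rel_trans (rel_mul_right h c) ?_
    rw [mul_comm b c, mul_comm b d]
    exact rel_mul_right h' b

end TPair

/-- The symmetrized tropical semiring `S_max(Γ)`, the quotient of the semiring of pairs. -/
def SMax (Γ : Type*) [AddCommGroup Γ] [LinearOrder Γ] [IsOrderedAddMonoid Γ] : Type _ :=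
  (TPair.con Γ).Quotient

namespace SMax

variable {Γ : Type*} [AddCommGroup Γ] [LinearOrder Γ] [IsOrderedAddMonoid Γ]

instance : CommSemiring (SMax Γ) := inferInstanceAs (CommSemiring (TPair.con Γ).Quotient)

/-- The class of the pair `(a₁, a₂)`. -/
def mk (a₁ a₂ : TMax Γ) : SMax Γ := ((⟨a₁, a₂⟩ : TPair Γ) : (TPair.con Γ).Quotient)

/-- The minus operator `⊖`, induced by `(a₁, a₂) ↦ (a₂, a₁)`. -/
instance : Neg (SMax Γ) :=
  ⟨Quotient.map' (fun a : TPair Γ => -a) fun _ _ h => TPair.rel_neg h⟩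

theorem mk_eq_mk {a₁ a₂ b₁ b₂ : TMax Γ} :
    mk a₁ a₂ = mk b₁ b₂ ↔ TPair.Rel ⟨a₁, a₂⟩ ⟨b₁, b₂⟩ := (TPair.con Γ).eq

theorem zero_def : (0 : SMax Γ) = mk 0 0 := rfl
theorem one_def : (1 : SMax Γ) = mk 1 0 := rfl
theorem neg_mk (a₁ a₂ : TMax Γ) : -mk a₁ a₂ = mk a₂ a₁ := rfl
theorem mk_add_mk (a₁ a₂ b₁ b₂ : TMax Γ) : mk a₁ a₂ + mk b₁ b₂ = mk (a₁ + b₁) (a₂ + b₂) := rfl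
theorem mk_mul_mk (a₁ a₂ b₁ b₂ : TMax Γ) :
    mk a₁ a₂ * mk b₁ b₂ = mk (a₁ * b₁ + a₂ * b₂) (a₁ * b₂ + a₂ * b₁) := rfl

theorem exists_mk (a : SMax Γ) : ∃ a₁ a₂, a = mk a₁ a₂ := by
  obtain ⟨⟨a₁, a₂⟩, rfl⟩ := Quotient.exists_rep a
  exact ⟨a₁, a₂, rfl⟩

variable (Γ)

/-- Positive or zero elements. -/
def nonneg : Set (SMax Γ) := {a | ∃ c : TMax Γ, a = mk c 0}

/-- Negative or zero elements. -/
def nonpos : Set (SMax Γ) := {a | ∃ c : TMax Γ, a = mk 0 c}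

/-- Balance elements. -/
def balanced : Set (SMax Γ) := {a | ∃ c : TMax Γ, a = mk c c}

/-- Signed elements, `S_max^∨`. -/
def signed : Set (SMax Γ) := nonneg Γ ∪ nonpos Γ

variable {Γ}

/-- The relation `a ⪯° b`: `b = a ⊕ c` for some balance element `c`. -/
def Surpass (a b : SMax Γ) : Prop := ∃ c ∈ balanced Γ, b = a + c

theorem neg_neg' (a : SMax Γ) : - -a = a := by
  obtain ⟨a₁, a₂, rfl⟩ := exists_mk a
  rfl

theorem neg_add' (a b : SMax Γ) : -(a + b) = -a + -b := by
  obtain ⟨a₁, a₂, rfl⟩ := exists_mk a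
  obtain ⟨b₁, b₂, rfl⟩ := exists_mk b
  rfl

theorem neg_mul' (a b : SMax Γ) : -(a * b) = -a * b := by
  obtain ⟨a₁, a₂, rfl⟩ := exists_mk a
  obtain ⟨b₁, b₂, rfl⟩ := exists_mk b
  simp only [neg_mk, mk_mul_mk]
  congr 1 <;> ring

theorem mk_self_eq {a₁ a₂ c : TMax Γ} : mk a₁ a₂ = mk c c ↔ a₁ = c ∧ a₂ = c := by
  rw [mk_eq_mk, TPair.rel_iff]
  simp

theorem pos_ne_zero {c : TMax Γ} : mk c 0 ≠ 0 ↔ c ≠ 0 := by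
  rw [zero_def, Ne, mk_self_eq]
  simp

theorem neg_ne_zero' {a : SMax Γ} (h : a ≠ 0) : -a ≠ 0 := fun h' => h (by
  rw [← neg_neg' a, h']; rfl)

theorem signed_cases {a : SMax Γ} (h : a ∈ signed Γ) : ∃ c, a = mk c 0 ∨ a = -mk c 0 := by
  rcases h with ⟨c, rfl⟩ | ⟨c, rfl⟩
  · exact ⟨c, Or.inl rfl⟩
  · exact ⟨c, Or.inr rfl⟩

theorem neg_mem_signed {a : SMax Γ} (h : a ∈ signed Γ) : -a ∈ signed Γ := by
  rcases h with ⟨c, rfl⟩ | ⟨c, rfl⟩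
  · exact Or.inr ⟨c, rfl⟩
  · exact Or.inl ⟨c, rfl⟩

theorem exists_inv {a : SMax Γ} (h : a ∈ signed Γ) (h0 : a ≠ 0) : ∃ b : SMax Γ, b * a = 1 := by
  have key : ∀ c : TMax Γ, c ≠ 0 → ∃ d, mk d 0 * mk c 0 = (1 : SMax Γ) := by
    intro c hc
    obtain ⟨d, hd⟩ := TMax.exists_inv hc
    exact ⟨d, by simp [mk_mul_mk, hd, one_def]⟩
  obtain ⟨c, rfl | rfl⟩ := signed_cases h
  · obtain ⟨d, hd⟩ := key c (pos_ne_zero.1 h0)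
    exact ⟨_, hd⟩
  · have hc : c ≠ 0 := by
      rintro rfl
      exact h0 rfl
    obtain ⟨d, hd⟩ := key c hc
    refine ⟨-mk d 0, ?_⟩
    rw [← neg_mul', mul_comm, ← neg_mul', mul_comm, hd, neg_neg']

theorem zero_ne_one' : (1 : SMax Γ) ≠ 0 := by
  rw [one_def, pos_ne_zero]
  exact TMax.zero_ne_one'.symm

theorem mul_mem_signed {a b : SMax Γ} (ha : a ∈ signed Γ) (hb : b ∈ signed Γ) :
    a * b ∈ signed Γ := by
  have key : ∀ c d : TMax Γ, mk c 0 * mk d 0 ∈ signed Γ := fun c d =>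
    Or.inl ⟨c * d, by simp [mk_mul_mk]⟩
  obtain ⟨c, rfl | rfl⟩ := signed_cases ha <;> obtain ⟨d, rfl | rfl⟩ := signed_cases hb
  · exact key c d
  · rw [mul_comm, ← neg_mul']
    exact neg_mem_signed (key d c)
  · rw [← neg_mul']
    exact neg_mem_signed (key c d)
  · rw [← neg_mul', mul_comm, ← neg_mul', neg_neg']
    exact key d c

theorem balanced_add {a b : SMax Γ} (ha : a ∈ balanced Γ) (hb : b ∈ balanced Γ) :
    a + b ∈ balanced Γ := by
  obtain ⟨c, rfl⟩ := ha
  obtain ⟨d, rfl⟩ := hb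
  exact ⟨c + d, rfl⟩

theorem balanced_mul {a : SMax Γ} (b : SMax Γ) (ha : a ∈ balanced Γ) : b * a ∈ balanced Γ := by
  obtain ⟨c, rfl⟩ := ha
  obtain ⟨b₁, b₂, rfl⟩ := exists_mk b
  exact ⟨b₁ * c + b₂ * c, rfl⟩

theorem zero_mem_balanced : (0 : SMax Γ) ∈ balanced Γ := ⟨0, rfl⟩

theorem surpass_eq {b b' : SMax Γ} (hb : b ∈ signed Γ) (hb' : b' ∈ signed Γ)
    (h : Surpass b b') : b = b' := by
  have z := fun x : TMax Γ => TMax.zero_le' x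
  obtain ⟨_, ⟨e, rfl⟩, he⟩ := h
  rcases hb with ⟨c, rfl⟩ | ⟨c, rfl⟩ <;> rcases hb' with ⟨d, rfl⟩ | ⟨d, rfl⟩ <;>
  · rw [mk_add_mk, mk_eq_mk, TPair.rel_iff] at he
    rw [mk_eq_mk, TPair.rel_iff]
    have := z c
    have := z d
    have := z e
    simp only [TMax.add_eq_max, TPair.mk.injEq] at he ⊢
    grind

theorem unique_neg {b b' : SMax Γ} (hb : b ∈ signed Γ) (hb' : b' ∈ signed Γ)
    (h : Surpass 0 (b + -b')) : b = b' := by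
  have z := fun x : TMax Γ => TMax.zero_le' x
  obtain ⟨_, ⟨e, rfl⟩, he⟩ := h
  rw [zero_add] at he
  rcases hb with ⟨c, rfl⟩ | ⟨c, rfl⟩ <;> rcases hb' with ⟨d, rfl⟩ | ⟨d, rfl⟩ <;>
  · rw [neg_mk, mk_add_mk, mk_self_eq] at he
    rw [mk_eq_mk, TPair.rel_iff]
    have := z c
    have := z d
    simp only [TMax.add_eq_max, TPair.mk.injEq] at he ⊢
    grind

end SMax

/-- A commutative semiring system on a commutative semiring `A`. -/
structure SemiringSystem (A : Type*) [CommSemiring A] where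
  /-- The set of tangible elements. -/
  tangible : Submonoid A
  zero_notMem : (0 : A) ∉ tangible
  generates : AddSubmonoid.closure (tangible : Set A) = ⊤
  cancel : ∀ b ∈ tangible, ∀ a a' : A, b * a = b * a' → a = a'
  /-- The negation `⊖`. -/
  neg : A → A
  neg_neg : ∀ a, neg (neg a) = a
  neg_add : ∀ a b, neg (a + b) = neg a + neg b
  neg_mul : ∀ a b, neg (a * b) = neg a * b
  /-- The surpassing relation `⊴`. -/
  surpass : A → A → Prop
  refl : ∀ a, surpass a a
  trans : ∀ a b c, surpass a b → surpass b c → surpass a c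
  add_compat : ∀ a b c d, surpass a b → surpass c d → surpass (a + c) (b + d)
  mul_compat : ∀ a b c d, surpass a b → surpass c d → surpass (a * c) (b * d)
  surpass_zero : ∀ a, surpass 0 (a + neg a)
  eq_of_surpass : ∀ b b', (b ∈ tangible ∨ b = 0) → (b' ∈ tangible ∨ b' = 0) →
    surpass b b' → b = b'
  unique_neg : ∀ b b', (b ∈ tangible ∨ b = 0) → (b' ∈ tangible ∨ b' = 0) →
    surpass 0 (b + neg b') → b = b'

/-- Morphisms of semiring systems. -/
structure SemiringSystem.IsMorphism {A B : Type*} [CommSemiring A] [CommSemiring B]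
    (S : SemiringSystem A) (T : SemiringSystem B) (φ : A → B) : Prop where
  map_zero : φ 0 = 0
  map_tangible : ∀ a ∈ S.tangible, φ a ∈ T.tangible
  map_neg : ∀ a, φ (S.neg a) = T.neg (φ a)
  map_add : ∀ a a', T.surpass (φ (a + a')) (φ a + φ a')
  map_mul : ∀ b ∈ S.tangible, ∀ a, φ (b * a) = φ b * φ a
  map_surpass : ∀ a a', S.surpass a a' → T.surpass (φ a) (φ a')

/-- A field as a semiring system: tangible elements are the nonzero elements, the negation is
the usual one and the surpassing relation is equality. -/
def fieldSystem (K : Type*) [Field K] : SemiringSystem K where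
  tangible :=
    { carrier := {a | a ≠ 0}
      one_mem' := one_ne_zero
      mul_mem' := fun ha hb => mul_ne_zero ha hb }
  zero_notMem := fun h => h rfl
  generates := by
    rw [eq_top_iff]
    intro a _
    by_cases h : a = 0
    · rw [h]
      exact zero_mem _
    · exact AddSubmonoid.subset_closure h
  cancel b hb a a' h := mul_left_cancel₀ hb h
  neg a := -a
  neg_neg a := by ring
  neg_add a b := by ring
  neg_mul a b := by ring
  surpass a b := a = b
  refl _ := rfl
  trans _ _ _ h h' := h.trans h'
  add_compat _ _ _ _ h h' := by rw [h, h']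
  mul_compat _ _ _ _ h h' := by rw [h, h']
  surpass_zero a := by ring
  eq_of_surpass _ _ _ _ h := h
  unique_neg b b' _ _ h := by linear_combination -h

/-- The semiring system `S_max(Γ)`: tangible elements are the nonzero signed elements, the
negation is `⊖` and the surpassing relation is `⪯°`. -/
def SMax.system (Γ : Type*) [AddCommGroup Γ] [LinearOrder Γ] [IsOrderedAddMonoid Γ] :
    SemiringSystem (SMax Γ) where
  tangible :=
    { carrier := {a | a ∈ signed Γ ∧ a ≠ 0}
      one_mem' := ⟨Or.inl ⟨1, rfl⟩, zero_ne_one'⟩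
      mul_mem' := by
        rintro a b ⟨ha, ha0⟩ ⟨hb, hb0⟩
        refine ⟨mul_mem_signed ha hb, fun h => hb0 ?_⟩
        obtain ⟨c, hc⟩ := exists_inv ha ha0
        rw [← one_mul b, ← hc, mul_assoc, h, mul_zero] }
  zero_notMem := fun h => h.2 rfl
  generates := by
    rw [eq_top_iff]
    intro a _
    have key : ∀ x ∈ signed Γ,
        x ∈ AddSubmonoid.closure {a : SMax Γ | a ∈ signed Γ ∧ a ≠ 0} := by
      intro x hx
      by_cases h : x = 0
      · rw [h]
        exact zero_mem _
      · exact AddSubmonoid.subset_closure ⟨hx, h⟩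
    obtain ⟨a₁, a₂, rfl⟩ := exists_mk a
    have h : mk a₁ a₂ = mk a₁ 0 + mk 0 a₂ := by simp [mk_add_mk]
    rw [h]
    exact add_mem (key _ (Or.inl ⟨a₁, rfl⟩)) (key _ (Or.inr ⟨a₂, rfl⟩))
  cancel b hb a a' h := by
    obtain ⟨c, hc⟩ := exists_inv hb.1 hb.2
    rw [← one_mul a, ← one_mul a', ← hc, mul_assoc, mul_assoc, h]
  neg a := -a
  neg_neg := neg_neg'
  neg_add := neg_add'
  neg_mul := neg_mul'
  surpass := Surpass
  refl a := ⟨0, zero_mem_balanced, (add_zero a).symm⟩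
  trans := by
    rintro a _ _ ⟨c, hc, rfl⟩ ⟨d, hd, rfl⟩
    exact ⟨c + d, balanced_add hc hd, add_assoc _ _ _⟩
  add_compat := by
    rintro a _ c _ ⟨e, he, rfl⟩ ⟨f, hf, rfl⟩
    exact ⟨e + f, balanced_add he hf, by ring⟩
  mul_compat := by
    rintro a _ c _ ⟨e, he, rfl⟩ ⟨f, hf, rfl⟩
    exact ⟨a * f + c * e + e * f, balanced_add (balanced_add (balanced_mul a hf)
      (balanced_mul c he)) (balanced_mul e hf), by ring⟩
  surpass_zero a := by
    obtain ⟨a₁, a₂, rfl⟩ := exists_mk a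
    exact ⟨mk (a₁ + a₂) (a₁ + a₂), ⟨_, rfl⟩, by rw [neg_mk, mk_add_mk, zero_add, add_comm a₂]⟩
  eq_of_surpass b b' hb hb' h := by
    have h0 : (0 : SMax Γ) ∈ signed Γ := Or.inl ⟨0, rfl⟩
    exact surpass_eq (hb.elim (fun h => h.1) (fun h => h ▸ h0))
      (hb'.elim (fun h => h.1) (fun h => h ▸ h0)) h
  unique_neg b b' hb hb' h := by
    have h0 : (0 : SMax Γ) ∈ signed Γ := Or.inl ⟨0, rfl⟩
    exact SMax.unique_neg (hb.elim (fun h => h.1) (fun h => h ▸ h0))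
      (hb'.elim (fun h => h.1) (fun h => h ▸ h0)) h

/-- The formal polynomial `⨁_k φ(P_k) Y^k` obtained by applying `φ` to the coefficients. -/
noncomputable def mapCoeffs {A B : Type*} [CommSemiring A] [CommSemiring B] (φ : A → B)
    (P : A[X]) : B[X] :=
  ∑ k ∈ Finset.range (P.natDegree + 1), monomial k (φ (P.coeff k))

/-! Fix `y`. Expanding the product one linear factor at a time, each `sv (a - b) ⪯° sv a ⊖ sv b`
loses only a balanced summand, so the value of `P` at `y` is `⪯°` the product of the `y ⊖ sv (x i)`
(`eval_prod_surpass`). Equality comes from comparing moduli and balance.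

The map `a ↦ |sv a|` is multiplicative and ultrametric, and the modulus of the evaluation is the
Gauss norm of radius `|y|`. Multiplicativity of that norm on linear factors gives both sides the
same modulus (`modulus_eval_prod`).

If the product is not balanced, `⪯°` is already equality. If it is balanced, so is one factor `y ⊖
sv (x i)`, and this makes the value of `P` balanced too (`eval_mem_balanced_of_root`), because `x i`
is a root of `P`. A balanced element is determined by its modulus. -/

namespace TMax

variable {Γ : Type*} [AddCommGroup Γ] [LinearOrder Γ] [IsOrderedAddMonoid Γ]

/-! ### Order and finite maxima in `T_max` -/

theorem add_le_iff {a b c : TMax Γ} : a + b ≤ c ↔ a ≤ c ∧ b ≤ c := max_le_iff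

theorem mul_le_mul'' {a b c d : TMax Γ} (h : a ≤ b) (h' : c ≤ d) : a * c ≤ b * d :=
  (mul_mono a h').trans (by rw [mul_comm a, mul_comm b]; exact mul_mono d h)

theorem pow_mono {a b : TMax Γ} (h : a ≤ b) (k : ℕ) : a ^ k ≤ b ^ k := by
  induction k with
  | zero => simp
  | succ k ih => rw [pow_succ, pow_succ]; exact mul_le_mul'' ih h

theorem lt_of_mul_lt {a b c : TMax Γ} (h : a * c < b * c) : a < b := by
  by_contra hn
  exact absurd (mul_le_mul'' (not_lt.1 hn) (le_refl c)) (not_le.2 h)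

theorem sum_le_iff {ι : Type*} {s : Finset ι} {f : ι → TMax Γ} {b : TMax Γ} :
    ∑ i ∈ s, f i ≤ b ↔ ∀ i ∈ s, f i ≤ b := by
  classical
  induction s using Finset.induction_on with
  | empty => simp [zero_le']
  | insert a s ha ih => rw [Finset.sum_insert ha, add_le_iff, ih]; simp

theorem le_sum {ι : Type*} {s : Finset ι} (f : ι → TMax Γ) {i : ι} (hi : i ∈ s) :
    f i ≤ ∑ i ∈ s, f i := sum_le_iff.1 le_rfl i hi

theorem sum_mono {ι : Type*} {s : Finset ι} {f g : ι → TMax Γ} (h : ∀ i ∈ s, f i ≤ g i) :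
    ∑ i ∈ s, f i ≤ ∑ i ∈ s, g i := sum_le_iff.2 fun i hi => (h i hi).trans (le_sum g hi)

theorem exists_eq_sum {ι : Type*} {s : Finset ι} {f : ι → TMax Γ} (h : ∑ i ∈ s, f i ≠ 0) :
    ∃ i ∈ s, f i = ∑ i ∈ s, f i := by
  by_contra! hn
  have hlt : ∀ i ∈ s, f i < ∑ i ∈ s, f i := fun i hi => lt_of_le_of_ne (le_sum f hi) (hn i hi)
  have hs : s.Nonempty := Finset.nonempty_of_sum_ne_zero h
  obtain ⟨i, hi, hmax⟩ := s.exists_max_image f hs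
  exact absurd (hlt i hi) (not_lt.2 (sum_le_iff.2 hmax))

end TMax

/-! ### Modulus, signed and balanced elements of `S_max` -/

namespace SMax

variable {Γ : Type*} [AddCommGroup Γ] [LinearOrder Γ] [IsOrderedAddMonoid Γ]

/-- The modulus `|(a₁, a₂)| = a₁ ⊕ a₂`. -/
def modulus (Γ : Type*) [AddCommGroup Γ] [LinearOrder Γ] [IsOrderedAddMonoid Γ] :
    SMax Γ →+* TMax Γ where
  toFun := Quotient.lift (fun a : TPair Γ => a.fst + a.snd) fun a b h => by
    rcases (TPair.rel_iff a b).1 h with rfl | ⟨h1, h2, h3⟩ | ⟨h1, h2, h3⟩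
    · rfl
    · simp only [TMax.add_eq_max]; rw [max_eq_left h1.le, max_eq_left h2.le, h3]
    · simp only [TMax.add_eq_max]; rw [max_eq_right h1.le, max_eq_right h2.le, h3]
  map_zero' := zero_add (0 : TMax Γ)
  map_one' := add_zero (1 : TMax Γ)
  map_add' a b := by
    obtain ⟨a₁, a₂, rfl⟩ := exists_mk a
    obtain ⟨b₁, b₂, rfl⟩ := exists_mk b
    exact add_add_add_comm a₁ b₁ a₂ b₂
  map_mul' a b := by
    obtain ⟨a₁, a₂, rfl⟩ := exists_mk a
    obtain ⟨b₁, b₂, rfl⟩ := exists_mk b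
    change (a₁ * b₁ + a₂ * b₂) + (a₁ * b₂ + a₂ * b₁) = (a₁ + a₂) * (b₁ + b₂)
    ring

theorem modulus_mk (a₁ a₂ : TMax Γ) : modulus Γ (mk a₁ a₂) = a₁ + a₂ := rfl

theorem modulus_neg (a : SMax Γ) : modulus Γ (-a) = modulus Γ a := by
  obtain ⟨a₁, a₂, rfl⟩ := exists_mk a
  exact add_comm a₂ a₁

theorem modulus_le_of_surpass {a b : SMax Γ} (h : Surpass a b) : modulus Γ a ≤ modulus Γ b := by
  obtain ⟨c, -, rfl⟩ := h
  rw [map_add]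
  exact le_max_left _ _

theorem mk_mem_balanced {a₁ a₂ : TMax Γ} : mk a₁ a₂ ∈ balanced Γ ↔ a₁ = a₂ := by
  constructor
  · rintro ⟨c, hc⟩
    rw [mk_self_eq] at hc
    rw [hc.1, hc.2]
  · rintro rfl
    exact ⟨_, rfl⟩

/-- When the coordinates differ, the congruence forgets the smaller one, which may be replaced by
`⊥`. -/
theorem signed_or_balanced (a : SMax Γ) : a ∈ signed Γ ∨ a ∈ balanced Γ := by
  obtain ⟨a₁, a₂, rfl⟩ := exists_mk a
  rcases lt_trichotomy a₁ a₂ with h | rfl | h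
  · refine Or.inl (Or.inr ⟨a₂, ?_⟩)
    rw [mk_eq_mk, TPair.rel_iff]
    exact Or.inr (Or.inr ⟨h, (TMax.zero_le' _).trans_lt h, rfl⟩)
  · exact Or.inr ⟨_, rfl⟩
  · refine Or.inl (Or.inl ⟨a₁, ?_⟩)
    rw [mk_eq_mk, TPair.rel_iff]
    exact Or.inr (Or.inl ⟨h, (TMax.zero_le' _).trans_lt h, rfl⟩)

theorem eq_zero_of_signed_of_balanced {a : SMax Γ} (h : a ∈ signed Γ) (h' : a ∈ balanced Γ) :
    a = 0 := by
  rcases h with ⟨c, rfl⟩ | ⟨c, rfl⟩ <;> rw [mk_mem_balanced] at h' <;> subst h' <;> rfl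

theorem eq_of_balanced_of_modulus_eq {a b : SMax Γ} (ha : a ∈ balanced Γ) (hb : b ∈ balanced Γ)
    (h : modulus Γ a = modulus Γ b) : a = b := by
  obtain ⟨c, rfl⟩ := ha
  obtain ⟨d, rfl⟩ := hb
  simp only [modulus_mk, TMax.add_eq_max, max_self] at h
  rw [h]

/-- A summand `(e, e)` either stays below the dominant coordinate of `a`, leaving its class
unchanged, or reaches it and balances the sum. -/
theorem eq_of_surpass_of_notMem_balanced {a b : SMax Γ} (h : Surpass a b)
    (hb : b ∉ balanced Γ) : a = b := by
  obtain ⟨_, ⟨e, rfl⟩, rfl⟩ := h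
  obtain ⟨a₁, a₂, rfl⟩ := exists_mk a
  rw [mk_add_mk, mk_mem_balanced] at hb
  rw [mk_add_mk, mk_eq_mk, TPair.rel_iff]
  simp only [TMax.add_eq_max, TPair.mk.injEq] at hb ⊢
  grind

/-- Unbalanced elements are exactly the tangible ones, which are closed under multiplication; a
signed balanced element is zero. -/
theorem mul_notMem_balanced {a b : SMax Γ} (ha : a ∉ balanced Γ) (hb : b ∉ balanced Γ) :
    a * b ∉ balanced Γ := by
  have hne : ∀ {a : SMax Γ}, a ∉ balanced Γ → a ≠ 0 := by
    rintro a ha rfl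
    exact ha zero_mem_balanced
  have hs : ∀ {a : SMax Γ}, a ∉ balanced Γ → a ∈ signed Γ := fun {a} ha =>
    (signed_or_balanced a).resolve_right ha
  exact fun h => ((SMax.system Γ).tangible.mul_mem (x := a) (y := b) ⟨hs ha, hne ha⟩
    ⟨hs hb, hne hb⟩).2 (eq_zero_of_signed_of_balanced (mul_mem_signed (hs ha) (hs hb)) h)

theorem exists_mem_balanced_of_prod {ι : Type*} {s : Finset ι} {f : ι → SMax Γ}
    (h : ∏ i ∈ s, f i ∈ balanced Γ) : ∃ i ∈ s, f i ∈ balanced Γ := by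
  classical
  by_contra! hn
  refine Finset.prod_induction f (· ∉ balanced Γ) (fun _ _ => mul_notMem_balanced) ?_ hn h
  rw [one_def, mk_mem_balanced]
  exact TMax.zero_ne_one'.symm

theorem sum_mem_balanced {ι : Type*} {s : Finset ι} {f : ι → SMax Γ}
    (h : ∀ i ∈ s, f i ∈ balanced Γ) : ∑ i ∈ s, f i ∈ balanced Γ :=
  Finset.sum_induction f (· ∈ balanced Γ) (fun _ _ => balanced_add) zero_mem_balanced h

theorem mem_balanced_of_zero_surpass {a : SMax Γ} (h : Surpass 0 a) : a ∈ balanced Γ := by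
  obtain ⟨c, hc, rfl⟩ := h
  rwa [zero_add]

/-- A signed `a` fills one coordinate only, so the opposite coordinate of `b` must be at least `|a|`
for the sum to balance. -/
theorem modulus_le_of_add_mem_balanced {a b : SMax Γ} (ha : a ∈ signed Γ)
    (h : a + b ∈ balanced Γ) : modulus Γ a ≤ modulus Γ b := by
  obtain ⟨b₁, b₂, rfl⟩ := exists_mk b
  rcases ha with ⟨c, rfl⟩ | ⟨c, rfl⟩ <;>
  · have := TMax.zero_le' b₁
    have := TMax.zero_le' b₂
    have := TMax.zero_le' c
    rw [mk_add_mk, mk_mem_balanced] at h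
    rw [modulus_mk, modulus_mk]
    simp only [TMax.add_eq_max] at h ⊢
    grind

theorem add_mem_balanced_of_modulus_le {a b : SMax Γ} (hb : b ∈ balanced Γ)
    (h : modulus Γ a ≤ modulus Γ b) : a + b ∈ balanced Γ := by
  obtain ⟨a₁, a₂, rfl⟩ := exists_mk a
  obtain ⟨c, rfl⟩ := hb
  rw [modulus_mk, modulus_mk] at h
  rw [mk_add_mk, mk_mem_balanced]
  simp only [TMax.add_eq_max] at h ⊢
  grind

theorem surpass_sum {ι : Type*} {s : Finset ι} {f g : ι → SMax Γ}
    (h : ∀ i ∈ s, Surpass (f i) (g i)) : Surpass (∑ i ∈ s, f i) (∑ i ∈ s, g i) := by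
  classical
  induction s using Finset.induction_on with
  | empty => exact (SMax.system Γ).refl 0
  | insert a s ha ih =>
    rw [Finset.sum_insert ha, Finset.sum_insert ha]
    exact (SMax.system Γ).add_compat _ _ _ _ (h a (Finset.mem_insert_self a s))
      (ih fun i hi => h i (Finset.mem_insert_of_mem hi))

theorem surpass_mul_right {a b : SMax Γ} (h : Surpass a b) (c : SMax Γ) :
    Surpass (a * c) (b * c) :=
  (SMax.system Γ).mul_compat _ _ _ _ h ((SMax.system Γ).refl c)

end SMax

/-! ### The valuation `|sv ·|` and evaluation of polynomials -/

namespace SemiringSystem.IsMorphism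

open SMax

variable {R : Type*} [Field R] {Γ : Type*} [AddCommGroup Γ] [LinearOrder Γ]
  [IsOrderedAddMonoid Γ] {sv : R → SMax Γ}

theorem sv_mem_signed (h : (fieldSystem R).IsMorphism (SMax.system Γ) sv) (a : R) :
    sv a ∈ signed Γ := by
  by_cases ha : a = 0
  · rw [ha, h.map_zero]
    exact Or.inl ⟨0, rfl⟩
  · exact (h.map_tangible a ha).1

theorem sv_mul (h : (fieldSystem R).IsMorphism (SMax.system Γ) sv) (a b : R) :
    sv (a * b) = sv a * sv b := by
  by_cases ha : a = 0
  · rw [ha, zero_mul, h.map_zero, zero_mul]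
  · exact h.map_mul a ha b

theorem sv_one (h : (fieldSystem R).IsMorphism (SMax.system Γ) sv) : sv 1 = 1 := by
  have h1 : sv 1 ∈ (SMax.system Γ).tangible := h.map_tangible 1 one_ne_zero
  refine (SMax.system Γ).cancel _ h1 _ _ ?_
  rw [← h.sv_mul, mul_one, mul_one]

theorem sv_pow (h : (fieldSystem R).IsMorphism (SMax.system Γ) sv) (a : R) (k : ℕ) :
    sv (a ^ k) = sv a ^ k := by
  induction k with
  | zero => simp [h.sv_one]
  | succ k ih => rw [pow_succ, h.sv_mul, ih, pow_succ]

theorem sv_neg (h : (fieldSystem R).IsMorphism (SMax.system Γ) sv) (a : R) : sv (-a) = -sv a :=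
  h.map_neg a

theorem sv_sub_surpass (h : (fieldSystem R).IsMorphism (SMax.system Γ) sv) (a b : R) :
    Surpass (sv (a - b)) (sv a + -sv b) := by
  rw [sub_eq_add_neg, ← h.sv_neg]
  exact h.map_add a (-b)

theorem sv_sum_surpass (h : (fieldSystem R).IsMorphism (SMax.system Γ) sv) {ι : Type*}
    (s : Finset ι) (f : ι → R) : Surpass (sv (∑ i ∈ s, f i)) (∑ i ∈ s, sv (f i)) := by
  classical
  induction s using Finset.induction_on with
  | empty =>
    rw [Finset.sum_empty, Finset.sum_empty, h.map_zero]
    exact (SMax.system Γ).refl 0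
  | insert a s ha ih =>
    rw [Finset.sum_insert ha, Finset.sum_insert ha]
    exact (SMax.system Γ).trans _ _ _ (h.map_add _ _)
      ((SMax.system Γ).add_compat _ _ _ _ ((SMax.system Γ).refl _) ih)

theorem modulus_sub_le (h : (fieldSystem R).IsMorphism (SMax.system Γ) sv) (a b : R) :
    modulus Γ (sv (a - b)) ≤ modulus Γ (sv a) + modulus Γ (sv b) := by
  have := modulus_le_of_surpass (h.sv_sub_surpass a b)
  rwa [_root_.map_add, modulus_neg] at this

/-- Write `a = (a - b) + b`: the ultrametric bound gives `|a| ≤ max |a - b| |b|`, and the second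
option is excluded. -/
theorem modulus_le_sub (h : (fieldSystem R).IsMorphism (SMax.system Γ) sv) {a b : R}
    (hab : modulus Γ (sv b) < modulus Γ (sv a)) :
    modulus Γ (sv a) ≤ modulus Γ (sv (a - b)) := by
  have h1 := h.modulus_sub_le (a - b) (-b)
  rw [sub_neg_eq_add, sub_add_cancel, h.sv_neg, modulus_neg] at h1
  exact (le_max_iff.1 h1).resolve_right (not_le.2 hab)

theorem modulus_le_sub' (h : (fieldSystem R).IsMorphism (SMax.system Γ) sv) {a b : R}
    (hab : modulus Γ (sv a) < modulus Γ (sv b)) :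
    modulus Γ (sv b) ≤ modulus Γ (sv (a - b)) := by
  have h1 := h.modulus_le_sub hab
  rwa [← neg_sub, h.sv_neg, modulus_neg] at h1

/-- `⨁_{k < N} sv(Q_k) c^k` passes to a product with a linear factor, up to `⪯°`. -/
theorem eval_mul_X_sub_C_surpass (h : (fieldSystem R).IsMorphism (SMax.system Γ) sv) {Q : R[X]}
    {N : ℕ} (hQ : Q.natDegree < N) (x : R) (y : SMax Γ) :
    Surpass (∑ k ∈ Finset.range (N + 1), sv ((Q * (X - C x)).coeff k) * y ^ k)
      ((∑ k ∈ Finset.range N, sv (Q.coeff k) * y ^ k) * (y + -sv x)) := by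
  have h1 : (∑ k ∈ Finset.range N, sv (Q.coeff k) * y ^ k) * (y + -sv x) =
      ∑ k ∈ Finset.range (N + 1), (sv ((Q * X).coeff k) + -sv (Q.coeff k * x)) * y ^ k := by
    simp only [add_mul, Finset.sum_add_distrib, mul_add]
    congr 1
    -- `Q * X` has no constant term, so its sum starts at degree 1 and shifts.
    · rw [Finset.sum_range_succ', coeff_mul_X_zero, h.map_zero, zero_mul, add_zero,
        Finset.sum_mul]
      refine Finset.sum_congr rfl fun k _ => ?_
      rw [coeff_mul_X, pow_succ, mul_assoc]
    -- The extra term of degree `N` vanishes since `Q` has degree below `N`.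
    · rw [Finset.sum_range_succ, coeff_eq_zero_of_natDegree_lt hQ, zero_mul, ← h.sv_neg 0,
        neg_zero, h.map_zero, zero_mul, add_zero, Finset.sum_mul]
      refine Finset.sum_congr rfl fun k _ => ?_
      rw [mul_comm (Q.coeff k), h.sv_mul, SMax.neg_mul']
      ring
  rw [h1]
  refine surpass_sum fun k _ => surpass_mul_right ?_ _
  rw [mul_sub, coeff_sub, coeff_mul_C]
  exact h.sv_sub_surpass _ _

/-- The modulus of the value depends on `y` only through `|y|`: it is a Gauss norm. -/
theorem modulus_eval (y : SMax Γ) (Q : R[X]) (N : ℕ) :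
    modulus Γ (∑ k ∈ Finset.range N, sv (Q.coeff k) * y ^ k) =
      ∑ k ∈ Finset.range N, modulus Γ (sv (Q.coeff k)) * modulus Γ y ^ k := by
  simp only [map_sum, _root_.map_mul, map_pow]

/-- Multiplicativity of the Gauss norm of radius `c`, for a linear factor. -/
theorem gaussNorm_mul_X_sub_C_ge (h : (fieldSystem R).IsMorphism (SMax.system Γ) sv) {Q : R[X]}
    {N : ℕ} (hQ : Q.natDegree < N) (x : R) (c : TMax Γ) :
    (∑ k ∈ Finset.range N, modulus Γ (sv (Q.coeff k)) * c ^ k) * (c + modulus Γ (sv x)) ≤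
      ∑ k ∈ Finset.range (N + 1), modulus Γ (sv ((Q * (X - C x)).coeff k)) * c ^ k := by
  set v : R → TMax Γ := fun a => modulus Γ (sv a) with hv
  have hmul : ∀ a b, v (a * b) = v a * v b := fun a b => by simp only [hv, h.sv_mul, _root_.map_mul]
  change (∑ k ∈ Finset.range N, v (Q.coeff k) * c ^ k) * (c + v x) ≤
    ∑ k ∈ Finset.range (N + 1), v ((Q * (X - C x)).coeff k) * c ^ k
  set G := ∑ k ∈ Finset.range N, v (Q.coeff k) * c ^ k with hG
  by_cases hG0 : G = 0
  · rw [hG0, zero_mul]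
    exact TMax.zero_le' _
  have hle : ∀ k, v (Q.coeff k) * c ^ k ≤ G := by
    intro k
    by_cases hk : k < N
    · exact TMax.le_sum (fun k => v (Q.coeff k) * c ^ k) (Finset.mem_range.2 hk)
    · have : v (Q.coeff k) = 0 := by
        rw [coeff_eq_zero_of_natDegree_lt (by omega)]
        simp only [hv, h.map_zero, _root_.map_zero]
      rw [this, zero_mul]
      exact TMax.zero_le' _
  have hsum := fun k (hk : k < N + 1) =>
    TMax.le_sum (fun k => v ((Q * (X - C x)).coeff k) * c ^ k) (Finset.mem_range.2 hk)
  rcases lt_or_ge c (v x) with hc | hc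
  -- Case `c < |x|`: take any `k` attaining `G`. In degree `k`, the part `Q_k x` strictly dominates
  -- `Q_(k-1)`, as `|Q_(k-1)| c^k ≤ G c < G |x|`.
  · rw [TMax.add_eq_max, max_eq_right hc.le]
    obtain ⟨k, hk, hkG⟩ := TMax.exists_eq_sum hG0
    refine le_trans ?_ (hsum k ((Finset.mem_range.1 hk).trans (Nat.lt_succ_self N)))
    rw [← hG] at hkG
    rw [← hkG, mul_right_comm, ← hmul]
    refine TMax.mul_le_mul'' ?_ le_rfl
    rw [mul_sub, coeff_sub, coeff_mul_C]
    refine h.modulus_le_sub' (TMax.lt_of_mul_lt (c := c ^ k) ?_)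
    change v _ * _ < v _ * _
    rw [hmul, mul_right_comm, hkG]
    refine lt_of_le_of_lt ?_ (TMax.mul_strictMono hG0 hc)
    cases k with
    | zero =>
      rw [coeff_mul_X_zero]
      simp only [hv, h.map_zero, _root_.map_zero, zero_mul]
      exact TMax.zero_le' _
    | succ k =>
      rw [coeff_mul_X, pow_succ, ← mul_assoc]
      exact TMax.mul_le_mul'' (hle k) le_rfl
  · rw [TMax.add_eq_max, max_eq_left hc]
    by_cases hc0 : c = 0
    · rw [hc0, mul_zero]
      exact TMax.zero_le' _
    -- Case `|x| ≤ c`: choose `k` attaining `G` whose successor does not. In degree `k + 1`, `Q_k`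
    -- then strictly dominates `Q_(k+1) x`, even when `|x| = c`. Without such a `k`, all later terms
    -- would equal `G ≠ 0`, though the coefficients eventually vanish.
    obtain ⟨k, hk, hkG, hmax⟩ : ∃ k, k < N ∧ v (Q.coeff k) * c ^ k = G ∧
        v (Q.coeff (k + 1)) * c ^ (k + 1) ≠ G := by
      by_contra! hn
      obtain ⟨k, hk, hkG⟩ := TMax.exists_eq_sum hG0
      have hall : ∀ j, v (Q.coeff (k + j)) * c ^ (k + j) = G := by
        intro j
        induction j with
        | zero => exact hkG
        | succ j ih =>
          refine hn (k + j) ?_ ih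
          by_contra hlt
          rw [coeff_eq_zero_of_natDegree_lt (by omega)] at ih
          simp only [hv, h.map_zero, _root_.map_zero, zero_mul] at ih
          exact hG0 ih.symm
      have h2 := hall N
      rw [coeff_eq_zero_of_natDegree_lt (by omega)] at h2
      simp only [hv, h.map_zero, _root_.map_zero, zero_mul] at h2
      exact hG0 h2.symm
    refine le_trans ?_ (hsum (k + 1) (by omega))
    rw [← hkG, mul_assoc, ← pow_succ]
    refine TMax.mul_le_mul'' ?_ le_rfl
    rw [mul_sub, coeff_sub, coeff_mul_C, coeff_mul_X]
    refine h.modulus_le_sub (TMax.lt_of_mul_lt (c := c ^ (k + 1)) ?_)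
    change v _ * _ < v _ * _
    have h3 := TMax.mul_strictMono hc0 (lt_of_le_of_ne (hle (k + 1)) hmax)
    rw [pow_succ c k, ← mul_assoc (v (Q.coeff k)), hkG, mul_comm G, ← pow_succ]
    refine lt_of_le_of_lt ?_ h3
    rw [mul_comm (Q.coeff (k + 1)), hmul, mul_assoc]
    exact TMax.mul_le_mul'' hc le_rfl

/-! ### Products of linear factors and balance at roots -/

variable {n : ℕ}

theorem eval_prod_surpass (h : (fieldSystem R).IsMorphism (SMax.system Γ) sv) (x : Fin n → R)
    (y : SMax Γ) :
    Surpass (∑ k ∈ Finset.range (n + 1), sv ((∏ i, (X - C (x i))).coeff k) * y ^ k)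
      (∏ i, (y + -sv (x i))) := by
  induction n with
  | zero =>
    simp only [zero_add, Finset.range_one, Finset.sum_singleton, Finset.univ_eq_empty,
      Finset.prod_empty, coeff_one_zero, h.sv_one, pow_zero, mul_one]
    exact (SMax.system Γ).refl 1
  | succ n ih =>
    rw [Fin.prod_univ_castSucc, Fin.prod_univ_castSucc]
    refine (SMax.system Γ).trans _ _ _ (h.eval_mul_X_sub_C_surpass ?_ _ y)
      (surpass_mul_right (ih fun i => x i.castSucc) _)
    rw [natDegree_finsetProd_X_sub_C_eq_card]
    simp

/-- `⪯°` gives one inequality; the other is the Gauss norm bound, iterated over the factors. -/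
theorem modulus_eval_prod (h : (fieldSystem R).IsMorphism (SMax.system Γ) sv) (x : Fin n → R)
    (y : SMax Γ) :
    modulus Γ (∑ k ∈ Finset.range (n + 1), sv ((∏ i, (X - C (x i))).coeff k) * y ^ k) =
      modulus Γ (∏ i, (y + -sv (x i))) := by
  refine le_antisymm (modulus_le_of_surpass (h.eval_prod_surpass x y)) ?_
  rw [modulus_eval]
  induction n with
  | zero => simp [h.sv_one]
  | succ n ih =>
    rw [Fin.prod_univ_castSucc, Fin.prod_univ_castSucc, _root_.map_mul, _root_.map_add, modulus_neg]
    refine le_trans (TMax.mul_le_mul'' (ih fun i => x i.castSucc) le_rfl)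
      (h.gaussNorm_mul_X_sub_C_ge ?_ _ _)
    rw [natDegree_finsetProd_X_sub_C_eq_card]
    simp

/-- Applying `sv` to `Q(a) = 0` yields `0 ⪯°` the evaluation at `sv a`. -/
theorem eval_sv_root_mem_balanced (h : (fieldSystem R).IsMorphism (SMax.system Γ) sv)
    {Q : R[X]} {N : ℕ} (hQ : Q.natDegree < N) {a : R} (ha : Q.eval a = 0) :
    ∑ k ∈ Finset.range N, sv (Q.coeff k) * sv a ^ k ∈ balanced Γ := by
  have h1 := h.sv_sum_surpass (Finset.range N) fun k => Q.coeff k * a ^ k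
  rw [← eval_eq_sum_range' hQ, ha, h.map_zero] at h1
  simp only [h.sv_mul, h.sv_pow] at h1
  exact mem_balanced_of_zero_surpass h1

theorem eval_mem_balanced_of_root (h : (fieldSystem R).IsMorphism (SMax.system Γ) sv)
    {Q : R[X]} {N : ℕ} (hQ : Q.natDegree < N + 1) {a : R} (ha : Q.eval a = 0) {y : SMax Γ}
    (hy : y + -sv a ∈ balanced Γ) :
    ∑ k ∈ Finset.range (N + 1), sv (Q.coeff k) * y ^ k ∈ balanced Γ := by
  have hr := h.eval_sv_root_mem_balanced hQ ha
  rcases signed_or_balanced y with hs | hb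
  -- A signed `y` balancing `sv a` equals `sv a`.
  · rwa [SMax.unique_neg hs (h.sv_mem_signed a) ⟨_, hy, (zero_add _).symm⟩]
  -- For balanced `y`, all terms of positive degree are balanced. Only the constant term may not be,
  -- and it is absorbed: balance at `sv a` bounds it by the other terms there, which only grow in
  -- modulus since `|sv a| ≤ |y|`.
  · rw [Finset.sum_range_succ', add_comm] at hr ⊢
    have hle : modulus Γ (sv a) ≤ modulus Γ y := by
      rw [← modulus_neg (sv a)]
      refine modulus_le_of_add_mem_balanced (neg_mem_signed (h.sv_mem_signed a)) ?_
      rwa [add_comm]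
    refine add_mem_balanced_of_modulus_le (sum_mem_balanced fun k _ => ?_) ?_
    · rw [pow_succ, ← mul_assoc]
      exact balanced_mul _ hb
    · rw [pow_zero, mul_one] at hr ⊢
      refine (modulus_le_of_add_mem_balanced (h.sv_mem_signed _) hr).trans ?_
      simp only [map_sum, _root_.map_mul, map_pow]
      exact TMax.sum_mono fun k _ => TMax.mul_mono _ (TMax.pow_mono hle _)

end SemiringSystem.IsMorphism

theorem mainTheorem11 {R : Type*} [Field R] [LinearOrder R] [IsStrictOrderedRing R]
    {Γ : Type*} [AddCommGroup Γ] [LinearOrder Γ] [IsOrderedAddMonoid Γ]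
    (hΓ : ∀ m : ℕ, 0 < m → ∀ a : Γ, ∃ b : Γ, m • b = a)
    (sv : R → SMax Γ) (hsv : (fieldSystem R).IsMorphism (SMax.system Γ) sv)
    (n : ℕ) (x : Fin n → R) (P : R[X]) (hP : P = ∏ i, (X - C (x i))) :
    ∀ y : SMax Γ, (mapCoeffs sv P).eval y = ∏ i, (y + -sv (x i)) := by
  intro y
  have hdeg : P.natDegree = n := by
    rw [hP, natDegree_finsetProd_X_sub_C_eq_card]
    simp
  have hsur := hsv.eval_prod_surpass x y
  have hmod := hsv.modulus_eval_prod x y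
  rw [← hP] at hsur hmod
  rw [mapCoeffs, eval_finsetSum, hdeg]
  simp only [eval_monomial]
  by_cases hb : ∏ i, (y + -sv (x i)) ∈ SMax.balanced Γ
  · obtain ⟨i, -, hi⟩ := SMax.exists_mem_balanced_of_prod hb
    refine SMax.eq_of_balanced_of_modulus_eq
      (hsv.eval_mem_balanced_of_root (a := x i) (by omega) ?_ hi) hb hmod
    rw [hP, eval_prod]
    exact Finset.prod_eq_zero (Finset.mem_univ i) (by simp)
  · exact SMax.eq_of_surpass_of_notMem_balanced hsur hb
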